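/- **Lemma.** Let $N\ge 2$, $S=\{1,\dots,N\}$, and let $Q=(q_{ij})_{i,j\in S}$ be an irreducible conservative $Q$-matrix, i.e. $q_{ij}\ge 0$ for $i\ne j$, $\sum_{j}q_{ij}=0$ for every $i$, and any two states are connected by a chain of transitions of positive rate. Let $K:S\to\mathbb R$, $Q_K=Q+\mathrm{diag}(K_1,\dots,K_N)$, and $$\eta_K=-\max_{\gamma\in\mathrm{spec}(Q_K)}\mathrm{Re}(\gamma),$$ where $\mathrm{spec}(Q_K)$ is the set of complex eigenvalues of $Q_K$, and suppose $\eta_K>0$. Then there exist $\delta_0\in(0,1)$ and $c>0$, depending only on $Q$ and $K$, such that the following holds. Let $(\Lambda(t))_{t\ge0}$ be any time-homogeneous continuous-time Markov chain on $S$ (on any probability space, with any initial distribution) with right-continuous paths having left limits and with transition rates $Q$, i.e. for all $t\ge 0$ and $i,j\in S$, $$\mathbb P(\Lambda(t+h)=j\mid\Lambda(t)=i)=\mathbf 1_{\{i=j\}}+q_{ij}h+o(h)\qquad(h\downarrow0)$$ whenever $\mathbb P(\Lambda(t)=i)>0$. Then for all $\delta\in(0,\delta_0)$ and all $t>0$,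 the random variable $\exp\big(\int_0^tK_{\Lambda(\lfloor s/\delta\rfloor\delta)}\,ds\big)$ is integrable and $$\mathbb E\exp\Big(\int_0^tK_{\Lambda(\lfloor s/\delta\rfloor\delta)}\,ds\Big)\le c\,e^{-\eta_Kt/2}.$$ -/

import Mathlib

open Filter Topology MeasureTheory ProbabilityTheory
open scoped NNReal

/-- `Q` is a (conservative) `Q`-matrix: nonnegative off-diagonal entries, zero row sums. -/
structure IsQMatrix {N : ℕ} (Q : Matrix (Fin N) (Fin N) ℝ) : Prop where
  offDiag_nonneg : ∀ i j, i ≠ j → 0 ≤ Q i j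
  row_sum : ∀ i, ∑ j, Q i j = 0

/-- Irreducibility of a `Q`-matrix: every state leads to every state along
transitions of positive rate. -/
def QIrreducible {N : ℕ} (Q : Matrix (Fin N) (Fin N) ℝ) : Prop :=
  ∀ i j, Relation.ReflTransGen (fun a b => a ≠ b ∧ 0 < Q a b) i j

/-- The `σ`-algebra generated by `Λ u`, `u ≤ s`. -/
abbrev pastSigma {N : ℕ} {Ω : Type*} (Λ : ℝ≥0 → Ω → Fin N) (s : ℝ≥0) : MeasurableSpace Ω :=
  ⨆ u : {u : ℝ≥0 // u ≤ s}, MeasurableSpace.comap (Λ u) inferInstance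

/-- `Λ` is, under `μ`, a time-homogeneous continuous-time Markov chain on the finite state space
`Fin N` with right-continuous paths having left limits and with transition rates `Q`:
`P(Λ (t + h) = j ∣ Λ t = i) = 𝟙 (i = j) + Q i j * h + o(h)` as `h ↓ 0`.
Elementary conditional probabilities are only spoken of when the conditioning event has positive
probability. The initial distribution is arbitrary. -/
structure IsMarkovChain {N : ℕ} (Q : Matrix (Fin N) (Fin N) ℝ) {Ω : Type*} [MeasurableSpace Ω]
    (μ : Measure Ω) (Λ : ℝ≥0 → Ω → Fin N) : Prop where
  measurable : ∀ t, Measurable (Λ t)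
  right_continuous : ∀ ω t, ContinuousWithinAt (fun s => Λ s ω) (Set.Ici t) t
  left_limit : ∀ ω t, 0 < t → ∃ i, Tendsto (fun s => Λ s ω) (𝓝[<] t) (𝓝 i)
  /-- the Markov property -/
  markov : ∀ (s h : ℝ≥0) (i j : Fin N) (A : Set Ω), MeasurableSet[pastSigma Λ s] A →
    μ (A ∩ {ω | Λ s ω = i}) ≠ 0 →
      (μ[|A ∩ {ω | Λ s ω = i}]).real {ω | Λ (s + h) ω = j}
        = (μ[|{ω | Λ s ω = i}]).real {ω | Λ (s + h) ω = j}
  /-- time-homogeneity -/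
  homogeneous : ∀ (s t h : ℝ≥0) (i j : Fin N),
    μ {ω | Λ s ω = i} ≠ 0 → μ {ω | Λ t ω = i} ≠ 0 →
      (μ[|{ω | Λ s ω = i}]).real {ω | Λ (s + h) ω = j}
        = (μ[|{ω | Λ t ω = i}]).real {ω | Λ (t + h) ω = j}
  /-- the transition rates -/
  rates : ∀ (t : ℝ≥0) (i j : Fin N), μ {ω | Λ t ω = i} ≠ 0 →
    Tendsto (fun h : ℝ≥0 =>
        ((μ[|{ω | Λ t ω = i}]).real {ω | Λ (t + h) ω = j} - (if i = j then 1 else 0)) / (h : ℝ))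
      (𝓝[>] 0) (𝓝 (Q i j))

/-- The set of real parts of the complex eigenvalues of `Q + diag K`. -/
def specRe {N : ℕ} (Q : Matrix (Fin N) (Fin N) ℝ) (K : Fin N → ℝ) : Set ℝ :=
  Complex.re '' spectrum ℂ ((Q + Matrix.diagonal K).map (algebraMap ℝ ℂ))

/-- `η_K`, minus the largest real part of an eigenvalue of `Q + diag K`. -/
noncomputable def etaK {N : ℕ} (Q : Matrix (Fin N) (Fin N) ℝ) (K : Fin N → ℝ) : ℝ :=
  -sSup (specRe Q K)

/-- The supremum in `etaK` is a maximum. -/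
theorem neg_etaK_isGreatest {N : ℕ} (hN : 2 ≤ N) (Q : Matrix (Fin N) (Fin N) ℝ)
    (K : Fin N → ℝ) : IsGreatest (specRe Q K) (-etaK Q K) := by
  have : Nonempty (Fin N) := ⟨⟨0, by omega⟩⟩
  have hne : (specRe Q K).Nonempty :=
    (spectrum.nonempty_of_isAlgClosed_of_finiteDimensional ℂ _).image _
  have hfin : (specRe Q K).Finite := (Matrix.finite_spectrum _).image _
  rw [etaK, neg_neg]
  exact ⟨hne.csSup_mem hfin, fun _ hx => le_csSup hfin.bddAbove hx⟩

/-- The last grid point `⌊s / δ⌋ * δ` before `s` (for `0 ≤ s`, `0 < δ`), as a time in `[0, ∞)`. -/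
noncomputable def gridTime (δ s : ℝ) : ℝ≥0 := Real.toNNReal ((⌊s / δ⌋ : ℝ) * δ)

/-!
The bound is a discrete supermartingale estimate. Put `A = Q + diag K` and `η = etaK Q K`.

* A vector `ξ ≥ 1` with `A ξ < -(η / 2) ξ` entrywise exists
  (`exists_ge_one_mulVec_lt_of_etaK_pos`). The shifted matrix `A + (3/4) η` has nonnegative
  off-diagonal entries and its spectrum lies in the open left half plane, so after adding a large
  multiple `s` of the identity and dividing by `s` one has a nonnegative matrix `C` of spectral
  radius less than one. By Gelfand's formula `‖C ^ m‖ ≤ 1` for some `m > 0`, and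
  `ξ = ∑ k < m, C ^ k 1` satisfies `C ξ = ξ - 1 + C ^ m 1 ≤ ξ`
  (`exists_ge_one_mulVec_nonpos`). No Perron eigenvector is needed.
* The transition probabilities of the chain are the entries of `exp (d Q)`
  (`transitionMatrix_eq_exp`), hence do not depend on the chain. They form a semigroup of
  contractions with derivative `Q` at `0`, and such a semigroup equals `exp (d Q)`, as one sees by
  comparing `P (t / k) ^ k` with `exp ((t / k) Q) ^ k` (`eq_exp_smul_of_semigroup`). Irreducibility
  guarantees that every state is visited, so that all transition probabilities are determined.
* Differentiating at `d = 0` gives `e ^ (d K i) (exp (d Q) ξ) i ≤ e ^ (-η d / 2) ξ i` for all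
  small `d > 0`, with a threshold depending on `Q` and `K` only
  (`eventually_exp_smul_mulVec_le`).
* By the Markov property, each grid step multiplies the expectation of
  `exp (d ∑ k < m, K (Λ (k d))) * ξ (Λ (m d))` by at most `e ^ (-η d / 2)`
  (`integral_gridWeight_mul_le`). The integral up to a time `t` off the grid differs from the one
  up to the last grid point by at most `∑ |K i|`, which goes into the constant.
-/

/-! ### Matrices with nonnegative entries and contraction semigroups -/

section MatrixFacts

open scoped Matrix Matrix.Norms.Operator

variable {n : Type*} [Fintype n] [DecidableEq n]

theorem Matrix.sum_row_le_norm (A : Matrix n n ℝ) (i : n) : ∑ j, A i j ≤ ‖A‖ := by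
  rw [Matrix.linfty_opNorm_def]
  refine le_trans ?_ (NNReal.coe_le_coe.2 (Finset.le_sup (f := fun i => ∑ j, ‖A i j‖₊)
    (Finset.mem_univ i)))
  push_cast
  exact Finset.sum_le_sum fun j _ => by simpa using le_abs_self (A i j)

theorem Matrix.norm_le_one_of_row_sum {A : Matrix n n ℝ} (h0 : ∀ i j, 0 ≤ A i j)
    (h1 : ∀ i, ∑ j, A i j = 1) : ‖A‖ ≤ 1 := by
  rw [Matrix.linfty_opNorm_def, NNReal.coe_le_one]
  refine Finset.sup_le fun i _ => ?_
  rw [← NNReal.coe_le_coe]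
  push_cast
  rw [← h1 i]
  exact (Finset.sum_congr rfl fun j _ => by
    rw [Real.norm_of_nonneg (h0 i j)]).le

theorem Matrix.norm_map_algebraMap_complex (A : Matrix n n ℝ) :
    ‖A.map (algebraMap ℝ ℂ)‖ = ‖A‖ := by
  simp [Matrix.linfty_opNorm_def]

theorem Complex.eventually_norm_add_lt {z : ℂ} (hz : z.re < 0) :
    ∀ᶠ s : ℝ in atTop, ‖z + s‖ < s := by
  filter_upwards [eventually_gt_atTop 0, eventually_gt_atTop (‖z‖ ^ 2 / (-2 * z.re))] with s h0 hs
  rw [div_lt_iff₀ (by linarith)] at hs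
  refine lt_of_pow_lt_pow_left₀ 2 h0.le ?_
  rw [Complex.sq_norm, Complex.normSq_apply] at hs ⊢
  simp only [Complex.add_re, Complex.add_im, Complex.ofReal_re, Complex.ofReal_im]
  nlinarith

/-- A consequence of Gelfand's formula: if the spectrum of `B` lies in the open disc of radius `s`,
then the norm of some positive power of `B` is at most the same power of `s`. -/
theorem exists_pow_norm_le_of_spectrum [Nonempty n] (B : Matrix n n ℝ) {s : ℝ} (hs : 0 < s)
    (h : ∀ z ∈ spectrum ℂ (B.map (algebraMap ℝ ℂ)), ‖z‖ < s) :
    ∃ m : ℕ, 0 < m ∧ ‖B ^ m‖ ≤ s ^ m := by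
  set Bc := B.map (algebraMap ℝ ℂ) with hBc
  lift s to ℝ≥0 using hs.le
  have h1 : spectralRadius ℂ Bc < s :=
    spectrum.spectralRadius_lt_of_forall_lt Bc fun z hz => by
      rw [← NNReal.coe_lt_coe, coe_nnnorm]; exact h z hz
  have h2 := (spectrum.pow_nnnorm_pow_one_div_tendsto_nhds_spectralRadius Bc).eventually_lt_const h1
  obtain ⟨m, hm, hm0⟩ := (h2.and (eventually_gt_atTop 0)).exists
  refine ⟨m, hm0, ?_⟩
  have hpow : Bc ^ m = (B ^ m).map (algebraMap ℝ ℂ) := by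
    rw [hBc]
    exact (map_pow (algebraMap ℝ ℂ).mapMatrix B m).symm
  have h3 := ENNReal.rpow_le_rpow hm.le (Nat.cast_nonneg m : (0 : ℝ) ≤ m)
  rw [← ENNReal.rpow_mul, one_div_mul_cancel (by positivity), ENNReal.rpow_one,
    ENNReal.rpow_natCast] at h3
  have h4 : ‖Bc ^ m‖₊ ≤ s ^ m := by exact_mod_cast h3
  rw [← Matrix.norm_map_algebraMap_complex, ← hpow]
  exact_mod_cast h4

theorem Matrix.pow_nonneg_entries {A : Matrix n n ℝ} (hA : ∀ i j, 0 ≤ A i j) (m : ℕ) :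
    ∀ i j, 0 ≤ (A ^ m) i j := by
  induction m with
  | zero => intro i j; rw [pow_zero, Matrix.one_apply]; split_ifs <;> simp
  | succ m ih =>
    intro i j
    rw [pow_succ, Matrix.mul_apply]
    exact Finset.sum_nonneg fun k _ => mul_nonneg (ih i k) (hA k j)

/-- The M-matrix criterion: a matrix with nonnegative off-diagonal entries whose complex spectrum
lies in the open left half plane has a positive vector `ξ` with `A ξ ≤ 0`. The vector is a partial
Neumann sum of the nonnegative matrix `(A + s) / s`, for `s` large. -/
theorem exists_ge_one_mulVec_nonpos [Nonempty n] (A : Matrix n n ℝ)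
    (hA : ∀ i j, i ≠ j → 0 ≤ A i j)
    (hspec : ∀ z ∈ spectrum ℂ (A.map (algebraMap ℝ ℂ)), z.re < 0) :
    ∃ ξ : n → ℝ, (∀ i, 1 ≤ ξ i) ∧ ∀ i, (A *ᵥ ξ) i ≤ 0 := by
  -- A finite subset of the open left half plane lies in the disc `‖z + s‖ < s` once `s` is large.
  obtain ⟨s, hs, hsd, hsz⟩ : ∃ s : ℝ, 0 < s ∧ (∀ i, -A i i ≤ s) ∧
      ∀ z ∈ spectrum ℂ (A.map (algebraMap ℝ ℂ)), ‖z + s‖ < s := by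
    have h1 : ∀ᶠ s : ℝ in atTop, ∀ z ∈ spectrum ℂ (A.map (algebraMap ℝ ℂ)), ‖z + s‖ < s :=
      ((Matrix.finite_spectrum _).eventually_all).2 fun z hz =>
        Complex.eventually_norm_add_lt (hspec z hz)
    have h2 : ∀ᶠ s : ℝ in atTop, ∀ i, -A i i ≤ s := eventually_all.2 fun i => eventually_ge_atTop _
    obtain ⟨s, h⟩ := ((eventually_gt_atTop 0).and (h2.and h1)).exists
    exact ⟨s, h⟩
  set B := A + s • (1 : Matrix n n ℝ) with hB
  have hB0 : ∀ i j, 0 ≤ B i j := by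
    intro i j
    rcases eq_or_ne i j with rfl | hij
    · have := hsd i
      simp [hB]; linarith
    · simpa [hB, hij] using hA i j hij
  have hBs : ∀ z ∈ spectrum ℂ (B.map (algebraMap ℝ ℂ)), ‖z‖ < s := by
    intro z hz
    have e : B.map (algebraMap ℝ ℂ)
        = A.map (algebraMap ℝ ℂ) + algebraMap ℂ (Matrix n n ℂ) (s : ℂ) := by
      ext i j
      rcases eq_or_ne i j with rfl | hij
      · simp [hB, Algebra.algebraMap_eq_smul_one]
      · simp [hB, hij, Algebra.algebraMap_eq_smul_one]
    have h1 : z - s ∈ spectrum ℂ (A.map (algebraMap ℝ ℂ)) := by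
      rw [← spectrum.add_mem_add_iff (s := (s : ℂ))]
      rwa [sub_add_cancel, add_comm (algebraMap ℂ _ _), ← e]
    simpa using hsz _ h1
  obtain ⟨m, hm0, hm⟩ := exists_pow_norm_le_of_spectrum B hs hBs
  set C := s⁻¹ • B with hC
  have hC0 : ∀ i j, 0 ≤ C i j := fun i j => mul_nonneg (inv_nonneg.2 hs.le) (hB0 i j)
  have hCm : ∀ i, ((C ^ m) *ᵥ 1) i ≤ 1 := by
    intro i
    have h1 : ‖C ^ m‖ ≤ 1 := by
      rw [hC, smul_pow, norm_smul, norm_pow, norm_inv, Real.norm_of_nonneg hs.le, inv_pow]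
      rw [inv_mul_le_iff₀ (by positivity), mul_one]
      exact hm
    refine le_trans ?_ h1
    simpa [Matrix.mulVec, dotProduct] using Matrix.sum_row_le_norm (C ^ m) i
  have hCn : ∀ k i, 0 ≤ ((C ^ k) *ᵥ 1) i := fun k i =>
    Finset.sum_nonneg fun j _ => by simpa using Matrix.pow_nonneg_entries hC0 k i j
  set ξ : n → ℝ := ∑ k ∈ Finset.range m, (C ^ k) *ᵥ 1 with hξ
  -- The partial Neumann sum telescopes.
  have hCξ : C *ᵥ ξ = ξ - 1 + (C ^ m) *ᵥ 1 := by
    have h1 : C *ᵥ ξ = ∑ k ∈ Finset.range m, (C ^ (k + 1)) *ᵥ 1 := by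
      rw [hξ, Matrix.mulVec_sum]
      exact Finset.sum_congr rfl fun k _ => by rw [Matrix.mulVec_mulVec, pow_succ']
    have h2 := Finset.sum_range_succ (fun k => (C ^ k) *ᵥ (1 : n → ℝ)) m
    rw [Finset.sum_range_succ'] at h2
    rw [h1, hξ]
    simp only [pow_zero, Matrix.one_mulVec] at h2
    rw [eq_sub_of_add_eq h2]
    abel
  refine ⟨ξ, fun i => ?_, fun i => ?_⟩
  · rw [hξ, Finset.sum_apply]
    refine le_trans ?_ (Finset.single_le_sum (fun k _ => hCn k i) (Finset.mem_range.2 hm0))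
    simp
  · have hA' : A *ᵥ ξ = s • (C *ᵥ ξ) - s • ξ := by
      have : A = s • C - s • 1 := by
        rw [hC, smul_smul, mul_inv_cancel₀ hs.ne', one_smul, hB]; abel
      rw [this, Matrix.sub_mulVec, Matrix.smul_mulVec s C, Matrix.smul_mulVec s 1,
        Matrix.one_mulVec]
    have := hCm i
    rw [hA', hCξ]
    simp only [Pi.sub_apply, Pi.smul_apply, Pi.add_apply, Pi.one_apply, smul_eq_mul]
    nlinarith

/-- Telescoping bound for the difference of two powers, one of them of a contraction. No
commutativity is assumed. -/
theorem norm_pow_sub_pow_le {R : Type*} [NormedRing R] [NormOneClass R] {a b : R} {c : ℝ}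
    (hc : 1 ≤ c) (ha : ‖a‖ ≤ 1) (hb : ‖b‖ ≤ c) (k : ℕ) : ‖a ^ k - b ^ k‖ ≤ k * c ^ k * ‖a - b‖ := by
  induction k with
  | zero => simp
  | succ k ih =>
    have e : a ^ (k + 1) - b ^ (k + 1) = a * (a ^ k - b ^ k) + (a - b) * b ^ k := by
      rw [pow_succ', pow_succ']; noncomm_ring
    have hbk : ‖b ^ k‖ ≤ c ^ k := (norm_pow_le b k).trans (pow_le_pow_left₀ (norm_nonneg _) hb k)
    have hck : c ^ k ≤ c ^ (k + 1) := pow_le_pow_right₀ hc (Nat.le_succ k)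
    calc ‖a ^ (k + 1) - b ^ (k + 1)‖
        ≤ ‖a‖ * ‖a ^ k - b ^ k‖ + ‖a - b‖ * ‖b ^ k‖ := by
          rw [e]
          exact (norm_add_le _ _).trans (add_le_add (norm_mul_le _ _) (norm_mul_le _ _))
      _ ≤ 1 * (k * c ^ k * ‖a - b‖) + ‖a - b‖ * c ^ k := by gcongr
      _ = (k + 1) * c ^ k * ‖a - b‖ := by ring
      _ ≤ ((k + 1 : ℕ) : ℝ) * c ^ (k + 1) * ‖a - b‖ := by push_cast; gcongr

theorem norm_exp_le_exp_norm {R : Type*} [NormedRing R] [NormedAlgebra ℝ R] [NormOneClass R]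
    [CompleteSpace R] (x : R) : ‖NormedSpace.exp x‖ ≤ Real.exp ‖x‖ := by
  have h1 : HasSum (fun k : ℕ => (k.factorial⁻¹ : ℝ) • x ^ k) (NormedSpace.exp x) :=
    NormedSpace.exp_series_hasSum_exp' x
  have h2 : HasSum (fun k : ℕ => (k.factorial⁻¹ : ℝ) • ‖x‖ ^ k) (Real.exp ‖x‖) := by
    rw [Real.exp_eq_exp_ℝ]
    exact NormedSpace.exp_series_hasSum_exp' ‖x‖
  rw [← h1.tsum_eq]
  refine tsum_of_norm_bounded h2 fun k => ?_
  rw [norm_smul, Real.norm_of_nonneg (by positivity), smul_eq_mul]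
  gcongr
  exact norm_pow_le x k

/-- A semigroup of contractions in a Banach algebra with right derivative `Q` at `0` is
`t ↦ exp (t Q)`. The difference at time `t` is bounded by `k` times a constant times the difference
at time `t / k`, which is `o(1 / k)`. -/
theorem eq_exp_smul_of_semigroup {R : Type*} [NormedRing R] [NormedAlgebra ℝ R] [NormOneClass R]
    [CompleteSpace R] (P : ℝ≥0 → R) (Q : R)
    (hP0 : P 0 = 1) (hadd : ∀ s h, P (s + h) = P s * P h) (hnorm : ∀ s, ‖P s‖ ≤ 1)
    (hder : Tendsto (fun h : ℝ≥0 => (h : ℝ)⁻¹ • (P h - 1)) (𝓝[>] 0) (𝓝 Q)) (t : ℝ≥0) :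
    P t = NormedSpace.exp ((t : ℝ) • Q) := by
  let := NormedAlgebra.restrictScalars ℚ ℝ R
  have hpow : ∀ (k : ℕ) (h : ℝ≥0), P (k * h) = P h ^ k := by
    intro k h
    induction k with
    | zero => simpa using hP0
    | succ k ih => rw [Nat.cast_succ, add_mul, one_mul, hadd, ih, pow_succ]
  rcases eq_or_ne t 0 with rfl | ht
  · simp [hP0]
  have ht0 : 0 < t := pos_iff_ne_zero.2 ht
  set E : ℝ → R := fun h => NormedSpace.exp (h • Q) with hE
  have hEd : Tendsto (fun h : ℝ≥0 => (h : ℝ)⁻¹ • (E h - 1)) (𝓝[>] 0) (𝓝 Q) := by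
    have h1 : HasDerivAt E Q 0 := by
      simpa using hasDerivAt_exp_smul_const (𝕂 := ℝ) Q (0 : ℝ)
    have h2 := h1.tendsto_slope_zero_right
    have h3 : Tendsto (fun h : ℝ≥0 => (h : ℝ)) (𝓝[>] 0) (𝓝[>] 0) := by
      refine tendsto_nhdsWithin_iff.2 ⟨?_, ?_⟩
      · exact (NNReal.continuous_coe.tendsto' 0 0 rfl).mono_left nhdsWithin_le_nhds
      · filter_upwards [self_mem_nhdsWithin] with h hh
        exact NNReal.coe_pos.2 hh
    simpa [hE, Function.comp_def] using h2.comp h3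
  have hd : Tendsto (fun h : ℝ≥0 => ‖(h : ℝ)⁻¹ • (P h - E h)‖) (𝓝[>] 0) (𝓝 0) := by
    have := (hder.sub hEd).norm
    rw [sub_self, norm_zero] at this
    refine this.congr fun h => ?_
    rw [← smul_sub, sub_sub_sub_cancel_right]
  -- `k + 1` subdivisions, so that the step `t / (k + 1)` never divides by zero.
  have hseq : Tendsto (fun k : ℕ => t / (k + 1 : ℕ)) atTop (𝓝[>] (0 : ℝ≥0)) := by
    refine tendsto_nhdsWithin_iff.2 ⟨?_, Eventually.of_forall fun k => ?_⟩
    · exact (tendsto_const_div_atTop_nhds_zero_nat (𝕜 := ℝ≥0) t).comp (tendsto_add_atTop_nat 1)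
    · exact div_pos ht0 (by positivity)
  have hlim := ((hd.comp hseq).const_mul (Real.exp (t * ‖Q‖) * t))
  rw [mul_zero] at hlim
  have hle : ∀ k : ℕ, ‖P t - E t‖ ≤ Real.exp (t * ‖Q‖) * t *
      ((fun h : ℝ≥0 => ‖(h : ℝ)⁻¹ • (P h - E h)‖) ∘ fun k : ℕ => t / (k + 1 : ℕ)) k := by
    intro k
    set h : ℝ≥0 := t / (k + 1 : ℕ) with hh
    have hk : ((k + 1 : ℕ) : ℝ≥0) * h = t := mul_div_cancel₀ _ (by positivity)
    have hkr : ((k + 1 : ℕ) : ℝ) * (h : ℝ) = t := by exact_mod_cast congrArg NNReal.toReal hk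
    have hh0 : 0 < (h : ℝ) := NNReal.coe_pos.2 (div_pos ht0 (by positivity))
    have e1 : P t = P h ^ (k + 1) := by rw [← hpow, hk]
    have e2 : E t = E h ^ (k + 1) := by
      simp only [hE]
      rw [← NormedSpace.exp_nsmul, ← Nat.cast_smul_eq_nsmul ℝ, smul_smul, hkr]
    have hb : ‖E h‖ ≤ Real.exp (h * ‖Q‖) := by
      refine (norm_exp_le_exp_norm _).trans ?_
      rw [norm_smul, Real.norm_of_nonneg hh0.le]
    have := norm_pow_sub_pow_le (Real.one_le_exp (by positivity)) (hnorm h) hb (k + 1)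
    rw [← e1, ← e2] at this
    refine this.trans (le_of_eq ?_)
    rw [← Real.exp_nat_mul, ← mul_assoc, hkr]
    simp only [Function.comp, ← hh]
    rw [norm_smul, norm_inv, Real.norm_of_nonneg hh0.le, ← hkr]
    field_simp
  have h0 : ‖P t - E t‖ ≤ 0 := ge_of_tendsto' hlim hle
  exact sub_eq_zero.1 (norm_le_zero_iff.1 h0)

/-- If `(Q + diag K) ξ < -r ξ` entrywise, then one weighted step of `exp (d Q)` contracts `ξ` by
`exp (-r d)` for all small `d > 0`: the derivative of `e ^ (d (K i + r)) (exp (d Q) ξ) i` at `d = 0`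
is negative. -/
theorem eventually_exp_smul_mulVec_le (Q : Matrix n n ℝ) (K ξ : n → ℝ) (r : ℝ)
    (h : ∀ i, ((Q + Matrix.diagonal K) *ᵥ ξ) i < -r * ξ i) :
    ∀ᶠ d : ℝ in 𝓝[>] 0, ∀ i,
      Real.exp (d * K i) * (NormedSpace.exp (d • Q) *ᵥ ξ) i ≤ Real.exp (-r * d) * ξ i := by
  refine eventually_all.2 fun i => ?_
  have h1 : HasDerivAt (fun d : ℝ => NormedSpace.exp (d • Q)) Q 0 := by
    have := hasDerivAt_exp_smul_const (𝕂 := ℝ) Q (0 : ℝ)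
    rw [zero_smul, NormedSpace.exp_zero, one_mul] at this
    exact this
  have h2 : HasDerivAt (fun d : ℝ => (NormedSpace.exp (d • Q) *ᵥ ξ) i) ((Q *ᵥ ξ) i) 0 := by
    simp only [Matrix.mulVec, dotProduct]
    refine HasDerivAt.fun_sum fun j _ => HasDerivAt.mul_const ?_ _
    exact hasDerivAt_pi.1 (hasDerivAt_pi.1 h1 i) j
  have h3 : HasDerivAt (fun d : ℝ => Real.exp (d * (K i + r))) (K i + r) 0 := by
    simpa using ((hasDerivAt_id (0 : ℝ)).mul_const (K i + r)).exp
  have h4 := (h3.mul h2).tendsto_slope_zero_right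
  have hneg : (K i + r) * ξ i + (Q *ᵥ ξ) i < 0 := by
    have := h i
    rw [Matrix.add_mulVec, Pi.add_apply, Matrix.mulVec_diagonal] at this
    linarith
  simp only [zero_add, Pi.mul_apply, zero_smul, NormedSpace.exp_zero, Matrix.one_mulVec, zero_mul,
    Real.exp_zero, one_mul] at h4
  filter_upwards [h4.eventually_lt_const hneg, self_mem_nhdsWithin] with d hd hd0
  have hd0 : 0 < d := hd0
  rw [smul_eq_mul, inv_mul_lt_iff₀ hd0, mul_zero, sub_neg, mul_add, Real.exp_add, mul_assoc] at hd
  have e : Real.exp (d * r) * Real.exp (-r * d) = 1 := by rw [← Real.exp_add]; simp; ring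
  have hp := Real.exp_pos (-r * d)
  have := mul_le_mul_of_nonneg_left hd.le hp.le
  calc _ = (Real.exp (d * r) * Real.exp (-r * d)) *
        (Real.exp (d * K i) * (NormedSpace.exp (d • Q) *ᵥ ξ) i) := by rw [e, one_mul]
    _ = Real.exp (-r * d) * (Real.exp (d * K i) *
        (Real.exp (d * r) * (NormedSpace.exp (d • Q) *ᵥ ξ) i)) := by ring
    _ ≤ _ := this

end MatrixFacts

/-! ### Transition probabilities of the Markov chain -/

section MarkovChain

theorem measurable_pastSigma {N : ℕ} {Ω : Type*} (Λ : ℝ≥0 → Ω → Fin N)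
    {u s : ℝ≥0} (hus : u ≤ s) :
    Measurable[pastSigma Λ s] (Λ u) :=
  Measurable.mono (comap_measurable (Λ u))
    (le_iSup (fun u : {u : ℝ≥0 // u ≤ s} => MeasurableSpace.comap (Λ u) inferInstance) ⟨u, hus⟩)
    le_rfl

variable {N : ℕ} {Q : Matrix (Fin N) (Fin N) ℝ} {Ω : Type*} [MeasurableSpace Ω] {μ : Measure Ω}
  {Λ : ℝ≥0 → Ω → Fin N}

/-- Splitting an integral according to the value of a random variable with finitely many values. -/
theorem integral_mul_comp_finite {ι : Type*} [Fintype ι] [MeasurableSpace ι]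
    [MeasurableSingletonClass ι] {X : Ω → ι} (hX : Measurable X) {G : Ω → ℝ}
    (hG : Integrable G μ) (f : ι → ℝ) :
    ∫ ω, G ω * f (X ω) ∂μ = ∑ i, f i * ∫ ω in {ω | X ω = i}, G ω ∂μ := by
  have hm : ∀ i, MeasurableSet {ω | X ω = i} := fun i => hX (measurableSet_singleton i)
  have e : ∀ ω, G ω * f (X ω) = ∑ i, f i * {ω | X ω = i}.indicator G ω := by
    intro ω
    rw [Finset.sum_eq_single (X ω)]
    · simp [mul_comm]
    · intro i _ hi
      simp [hi.symm]
    · simp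
  simp_rw [e]
  rw [integral_finsetSum _ fun i _ => (hG.indicator (hm i)).const_mul _]
  simp_rw [integral_const_mul, integral_indicator (hm _)]

theorem exists_measure_ne_zero_of_rate_pos [IsFiniteMeasure μ] (h : IsMarkovChain Q μ Λ)
    {i j : Fin N} (hij : i ≠ j) (hq : 0 < Q i j) {t : ℝ≥0} (ht : μ {ω | Λ t ω = i} ≠ 0) :
    ∃ s, μ {ω | Λ s ω = j} ≠ 0 := by
  have h1 := (h.rates t i j ht).eventually_const_lt hq
  obtain ⟨d, hd⟩ := h1.exists
  refine ⟨t + d, fun h0 => ?_⟩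
  have h2 : (μ[|{ω | Λ t ω = i}]).real {ω | Λ (t + d) ω = j} = 0 := by
    rw [measureReal_def, cond_absolutelyContinuous h0, ENNReal.toReal_zero]
  rw [h2] at hd
  simp [hij] at hd

theorem exists_time_measure_ne_zero [IsProbabilityMeasure μ] (h : IsMarkovChain Q μ Λ)
    (hirr : QIrreducible Q) (j : Fin N) : ∃ s, μ {ω | Λ s ω = j} ≠ 0 := by
  obtain ⟨i, hi⟩ : ∃ i, μ {ω | Λ 0 ω = i} ≠ 0 := by
    by_contra! hc
    have : μ (⋃ i, {ω | Λ 0 ω = i}) = 0 := measure_iUnion_null hc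
    rw [show (⋃ i, {ω | Λ 0 ω = i}) = Set.univ from by ext; simp] at this
    simp at this
  have hr := hirr i j
  induction hr with
  | refl => exact ⟨0, hi⟩
  | tail _ hab ih =>
    obtain ⟨t, ht⟩ := ih
    exact exists_measure_ne_zero_of_rate_pos h hab.1 hab.2 ht

/-- The matrix of transition probabilities over a time lag `h`. The entry in row `i` is the
conditional probability given that the chain is in state `i` at the reference time `τ i`; it is
meaningful when that event has positive probability, and by homogeneity it then does not depend on
the choice of `τ i`. -/
noncomputable def transitionMatrix (μ : Measure Ω) (Λ : ℝ≥0 → Ω → Fin N) (τ : Fin N → ℝ≥0)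
    (h : ℝ≥0) : Matrix (Fin N) (Fin N) ℝ :=
  Matrix.of fun i j => (μ[|{ω | Λ (τ i) ω = i}]).real {ω | Λ (τ i + h) ω = j}

theorem pastSigma_le (h : IsMarkovChain Q μ Λ) (s : ℝ≥0) : pastSigma Λ s ≤ ‹MeasurableSpace Ω› :=
  iSup_le fun u => (h.measurable u.1).comap_le

/-- The Markov property together with homogeneity, in product form. It also holds when the
conditioning event is null, both sides then being zero. -/
theorem measureReal_inter_eq_mul_transitionMatrix [IsProbabilityMeasure μ]
    (h : IsMarkovChain Q μ Λ) {τ : Fin N → ℝ≥0} (hτ : ∀ i, μ {ω | Λ (τ i) ω = i} ≠ 0)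
    (s d : ℝ≥0) (i j : Fin N) {A : Set Ω} (hA : MeasurableSet[pastSigma Λ s] A) :
    μ.real ((A ∩ {ω | Λ s ω = i}) ∩ {ω | Λ (s + d) ω = j})
      = μ.real (A ∩ {ω | Λ s ω = i}) * transitionMatrix μ Λ τ d i j := by
  by_cases h0 : μ (A ∩ {ω | Λ s ω = i}) = 0
  · rw [measureReal_def, measureReal_def, h0, measure_mono_null Set.inter_subset_left h0]
    simp
  · have hs : μ {ω | Λ s ω = i} ≠ 0 := fun hc => h0 (measure_mono_null Set.inter_subset_right hc)
    have hm : MeasurableSet (A ∩ {ω | Λ s ω = i}) :=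
      (pastSigma_le h s _ hA).inter (h.measurable s (measurableSet_singleton i))
    have h1 : transitionMatrix μ Λ τ d i j
        = (μ[|A ∩ {ω | Λ s ω = i}]).real {ω | Λ (s + d) ω = j} := by
      rw [h.markov s d i j A hA h0, h.homogeneous s (τ i) d i j hs (hτ i)]
      rfl
    rw [h1, measureReal_def, measureReal_def, measureReal_def, ← cond_mul_eq_inter hm,
      ENNReal.toReal_mul, mul_comm]

/-- The Markov property for functionals of the past. Both sides are integrals of `F` against finite
measures that agree on the `σ`-algebra of the past. -/
theorem setIntegral_eq_transitionMatrix_mul [IsProbabilityMeasure μ]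
    (h : IsMarkovChain Q μ Λ) {τ : Fin N → ℝ≥0} (hτ : ∀ i, μ {ω | Λ (τ i) ω = i} ≠ 0)
    (s d : ℝ≥0) (i j : Fin N) {F : Ω → ℝ} (hF : Measurable[pastSigma Λ s] F) :
    ∫ ω in {ω | Λ s ω = i} ∩ {ω | Λ (s + d) ω = j}, F ω ∂μ
      = transitionMatrix μ Λ τ d i j * ∫ ω in {ω | Λ s ω = i}, F ω ∂μ := by
  have hm := pastSigma_le h s
  have hp : 0 ≤ transitionMatrix μ Λ τ d i j := measureReal_nonneg
  have hF' : StronglyMeasurable[pastSigma Λ s] F :=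
    Measurable.stronglyMeasurable hF
  have hE : (μ.restrict ({ω | Λ s ω = i} ∩ {ω | Λ (s + d) ω = j})).trim hm
      = (ENNReal.ofReal (transitionMatrix μ Λ τ d i j) • μ.restrict {ω | Λ s ω = i}).trim hm := by
    refine @Measure.ext _ (pastSigma Λ s) _ _ fun A hA => ?_
    rw [trim_measurableSet_eq hm hA, trim_measurableSet_eq hm hA, Measure.smul_apply,
      Measure.restrict_apply (hm _ hA), Measure.restrict_apply (hm _ hA), smul_eq_mul,
      ← Set.inter_assoc]
    have h1 := measureReal_inter_eq_mul_transitionMatrix h hτ s d i j hA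
    rw [measureReal_def, measureReal_def] at h1
    rw [← ENNReal.ofReal_toReal (measure_ne_top μ ((A ∩ {ω | Λ s ω = i}) ∩ _)), h1,
      ENNReal.ofReal_mul ENNReal.toReal_nonneg, ENNReal.ofReal_toReal (measure_ne_top _ _),
      mul_comm]
  rw [integral_trim hm hF', hE, ← integral_trim hm hF', integral_smul_measure,
    ENNReal.toReal_ofReal hp, smul_eq_mul]

theorem transitionMatrix_row_sum [IsProbabilityMeasure μ] (h : IsMarkovChain Q μ Λ)
    {τ : Fin N → ℝ≥0} (hτ : ∀ i, μ {ω | Λ (τ i) ω = i} ≠ 0) (d : ℝ≥0) (i : Fin N) :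
    ∑ j, transitionMatrix μ Λ τ d i j = 1 := by
  have := cond_isProbabilityMeasure (hτ i)
  have h1 := sum_measureReal_preimage_singleton (μ := μ[|{ω | Λ (τ i) ω = i}])
    (f := Λ (τ i + d)) Finset.univ
    fun j _ => h.measurable _ (measurableSet_singleton j)
  rw [Finset.coe_univ, Set.preimage_univ, probReal_univ] at h1
  exact h1

theorem transitionMatrix_zero [IsProbabilityMeasure μ] (h : IsMarkovChain Q μ Λ)
    {τ : Fin N → ℝ≥0} (hτ : ∀ i, μ {ω | Λ (τ i) ω = i} ≠ 0) :
    transitionMatrix μ Λ τ 0 = 1 := by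
  ext i j
  have hm : MeasurableSet {ω | Λ (τ i) ω = i} := h.measurable _ (measurableSet_singleton i)
  simp only [transitionMatrix, Matrix.of_apply, add_zero]
  rw [measureReal_def, cond_apply hm]
  rcases eq_or_ne i j with rfl | hij
  · rw [Set.inter_self, ENNReal.inv_mul_cancel (hτ i) (measure_ne_top _ _)]
    simp
  · rw [show {ω | Λ (τ i) ω = i} ∩ {ω | Λ (τ i) ω = j} = ∅ from ?_]
    · simp [hij]
    · ext ω
      simp only [Set.mem_inter_iff, Set.mem_ofPred_eq, Set.mem_empty_iff_false, iff_false]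
      rintro ⟨h1, h2⟩
      exact hij (h1.symm.trans h2)

/-- The Chapman–Kolmogorov equation. -/
theorem transitionMatrix_add [IsProbabilityMeasure μ] (h : IsMarkovChain Q μ Λ)
    {τ : Fin N → ℝ≥0} (hτ : ∀ i, μ {ω | Λ (τ i) ω = i} ≠ 0) (s d : ℝ≥0) :
    transitionMatrix μ Λ τ (s + d) = transitionMatrix μ Λ τ s * transitionMatrix μ Λ τ d := by
  ext i j
  have hpos : μ.real {ω | Λ (τ i) ω = i} ≠ 0 := by
    rw [measureReal_def, ENNReal.toReal_ne_zero]; exact ⟨hτ i, measure_ne_top _ _⟩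
  have huniv : ∀ (t r : ℝ≥0) (k l : Fin N),
      μ.real ({ω | Λ t ω = k} ∩ {ω | Λ (t + r) ω = l})
        = μ.real {ω | Λ t ω = k} * transitionMatrix μ Λ τ r k l := by
    intro t r k l
    simpa using measureReal_inter_eq_mul_transitionMatrix h hτ t r k l
      (A := Set.univ) (@MeasurableSet.univ _ (pastSigma Λ t))
  refine mul_left_cancel₀ hpos ?_
  rw [← huniv, Matrix.mul_apply, Finset.mul_sum]
  have hmE : MeasurableSet[pastSigma Λ (τ i + s)] {ω | Λ (τ i) ω = i} :=
    measurable_pastSigma Λ le_self_add (measurableSet_singleton i)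
  have h1 := sum_measureReal_preimage_singleton
    (μ := μ.restrict ({ω | Λ (τ i) ω = i} ∩ {ω | Λ (τ i + (s + d)) ω = j}))
    (f := Λ (τ i + s)) Finset.univ
    fun j _ => h.measurable _ (measurableSet_singleton j)
  rw [Finset.coe_univ, Set.preimage_univ, measureReal_restrict_apply_univ] at h1
  rw [← h1]
  refine Finset.sum_congr rfl fun k _ => ?_
  rw [measureReal_restrict_apply (h.measurable _ (measurableSet_singleton k)), ← mul_assoc,
    ← huniv, ← measureReal_inter_eq_mul_transitionMatrix h hτ (τ i + s) d k j hmE, add_assoc]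
  congr 1
  ext ω
  simp only [Set.mem_inter_iff, Set.mem_preimage, Set.mem_singleton_iff, Set.mem_ofPred_eq]
  tauto

open scoped Matrix.Norms.Operator in
/-- The transition probabilities are determined by the rates. -/
theorem transitionMatrix_eq_exp [IsProbabilityMeasure μ] (h : IsMarkovChain Q μ Λ)
    {τ : Fin N → ℝ≥0} (hτ : ∀ i, μ {ω | Λ (τ i) ω = i} ≠ 0) (d : ℝ≥0) :
    transitionMatrix μ Λ τ d = NormedSpace.exp ((d : ℝ) • Q) := by
  have : Nonempty Ω := nonempty_of_isProbabilityMeasure μ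
  have : Nonempty (Fin N) := this.map (Λ 0)
  refine eq_exp_smul_of_semigroup _ Q (transitionMatrix_zero h hτ) (transitionMatrix_add h hτ)
    (fun s => Matrix.norm_le_one_of_row_sum (fun i j => measureReal_nonneg)
      (transitionMatrix_row_sum h hτ s)) ?_ d
  refine tendsto_pi_nhds.2 fun i => tendsto_pi_nhds.2 fun j => ?_
  refine (h.rates (τ i) i j (hτ i)).congr fun r => ?_
  rw [div_eq_inv_mul]
  simp [transitionMatrix, Matrix.one_apply]

/-- One step of the supermartingale estimate: if the weighted transition matrix maps `ξ` below
`ρ ξ`, then, whatever the weight `F` accumulated in the past, a step costs a factor `ρ` in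
expectation. -/
theorem integral_mul_step_le [IsProbabilityMeasure μ] (h : IsMarkovChain Q μ Λ)
    (hirr : QIrreducible Q) (s d : ℝ≥0) (w ξ : Fin N → ℝ) (ρ : ℝ)
    (hstep : ∀ i, w i * (NormedSpace.exp ((d : ℝ) • Q)).mulVec ξ i ≤ ρ * ξ i)
    {F : Ω → ℝ} (hF : Measurable[pastSigma Λ s] F) (hint : Integrable F μ) (h0 : ∀ ω, 0 ≤ F ω) :
    ∫ ω, F ω * (w (Λ s ω) * ξ (Λ (s + d) ω)) ∂μ ≤ ρ * ∫ ω, F ω * ξ (Λ s ω) ∂μ := by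
  choose τ hτ using exists_time_measure_ne_zero h hirr
  have h1 := integral_mul_comp_finite (μ := μ) ((h.measurable s).prodMk (h.measurable (s + d))) hint
    (fun p : Fin N × Fin N => w p.1 * ξ p.2)
  rw [integral_mul_comp_finite (h.measurable s) hint ξ, h1, Fintype.sum_prod_type, Finset.mul_sum]
  refine Finset.sum_le_sum fun i _ => ?_
  have h2 : ∀ j, ∫ ω in {ω | (Λ s ω, Λ (s + d) ω) = (i, j)}, F ω ∂μ
      = NormedSpace.exp ((d : ℝ) • Q) i j * ∫ ω in {ω | Λ s ω = i}, F ω ∂μ := by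
    intro j
    rw [← transitionMatrix_eq_exp h hτ, ← setIntegral_eq_transitionMatrix_mul h hτ s d i j hF]
    simp only [Prod.mk.injEq]
    rfl
  simp_rw [h2]
  have hI : 0 ≤ ∫ ω in {ω | Λ s ω = i}, F ω ∂μ := integral_nonneg h0
  calc _ = w i * (NormedSpace.exp ((d : ℝ) • Q)).mulVec ξ i * ∫ ω in {ω | Λ s ω = i}, F ω ∂μ := by
        rw [Matrix.mulVec, dotProduct, Finset.mul_sum, Finset.sum_mul]
        exact Finset.sum_congr rfl fun j _ => by ring
    _ ≤ ρ * ξ i * ∫ ω in {ω | Λ s ω = i}, F ω ∂μ := mul_le_mul_of_nonneg_right (hstep i) hI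
    _ = _ := by ring

end MarkovChain

/-! ### The exponential functional along the grid -/

section GridFunctional

variable {N : ℕ} {Q : Matrix (Fin N) (Fin N) ℝ} {Ω : Type*}
  {Λ : ℝ≥0 → Ω → Fin N}

/-- The weight `exp (d ∑ k < m, K (Λ (k d)))` accumulated over the first `m` steps of the grid of
mesh `d`, written as a product. -/
noncomputable def gridWeight (K : Fin N → ℝ) (Λ : ℝ≥0 → Ω → Fin N) (d : ℝ≥0) (m : ℕ) (ω : Ω) : ℝ :=
  ∏ k ∈ Finset.range m, Real.exp (d * K (Λ (k * d) ω))

theorem gridWeight_pos (K : Fin N → ℝ) (Λ : ℝ≥0 → Ω → Fin N) (d : ℝ≥0) (m : ℕ) (ω : Ω) :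
    0 < gridWeight K Λ d m ω :=
  Finset.prod_pos fun _ _ => Real.exp_pos _

theorem measurable_gridWeight (K : Fin N → ℝ) (Λ : ℝ≥0 → Ω → Fin N) (d : ℝ≥0) (m : ℕ) :
    Measurable[pastSigma Λ (m * d)] (gridWeight K Λ d m) := by
  refine Finset.measurable_fun_prod _ fun k hk => ?_
  have hkm : (k : ℝ≥0) * d ≤ m * d := by
    gcongr
    exact (Finset.mem_range.1 hk).le
  exact (Measurable.of_discrete (f := fun i => Real.exp (d * K i))).comp
    (measurable_pastSigma Λ hkm)

theorem integrable_gridWeight_mul [MeasurableSpace Ω] {μ : Measure Ω} [IsFiniteMeasure μ]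
    (h : IsMarkovChain Q μ Λ) (K : Fin N → ℝ) (d : ℝ≥0) (m : ℕ) (f : Fin N → ℝ) :
    Integrable (fun ω => gridWeight K Λ d m ω * f (Λ (m * d) ω)) μ := by
  have hK : ∀ i, K i ≤ ∑ j, |K j| := fun i =>
    (le_abs_self _).trans (Finset.single_le_sum (fun j _ => abs_nonneg (K j)) (Finset.mem_univ i))
  have hf : ∀ i, |f i| ≤ ∑ j, |f j| := fun i =>
    Finset.single_le_sum (fun j _ => abs_nonneg (f j)) (Finset.mem_univ i)
  refine Integrable.of_bound (Measurable.aestronglyMeasurable ?_)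
    (Real.exp (d * ∑ j, |K j|) ^ m * ∑ j, |f j|) (ae_of_all _ fun ω => ?_)
  · exact ((measurable_gridWeight K Λ d m).mono (pastSigma_le h _) le_rfl).mul
      ((Measurable.of_discrete (f := f)).comp (h.measurable _))
  · rw [norm_mul, Real.norm_of_nonneg (gridWeight_pos K Λ d m ω).le, Real.norm_eq_abs]
    refine mul_le_mul ?_ (hf _) (abs_nonneg _) (by positivity)
    refine (Finset.prod_le_prod (fun _ _ => (Real.exp_pos _).le) fun k _ =>
      Real.exp_le_exp.2 (mul_le_mul_of_nonneg_left (hK _) d.2)).trans ?_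
    simp

theorem integral_gridWeight_mul_le [MeasurableSpace Ω] {μ : Measure Ω} [IsProbabilityMeasure μ]
    (h : IsMarkovChain Q μ Λ) (hirr : QIrreducible Q) (K ξ : Fin N → ℝ) (d : ℝ≥0) {ρ C : ℝ}
    (hρ : 0 ≤ ρ) (hC : ∀ i, ξ i ≤ C)
    (hstep : ∀ i, Real.exp (d * K i) * (NormedSpace.exp ((d : ℝ) • Q)).mulVec ξ i ≤ ρ * ξ i)
    (m : ℕ) : ∫ ω, gridWeight K Λ d m ω * ξ (Λ (m * d) ω) ∂μ ≤ ρ ^ m * C := by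
  induction m with
  | zero =>
    have h1 : ∫ ω, gridWeight K Λ d 0 ω * ξ (Λ ((0 : ℕ) * d) ω) ∂μ ≤ ∫ _, C ∂μ :=
      integral_mono (integrable_gridWeight_mul h K d 0 ξ) (integrable_const C) fun ω => by
        simpa [gridWeight] using hC _
    simpa using h1
  | succ m ih =>
    have hint : Integrable (gridWeight K Λ d m) μ := by
      simpa using integrable_gridWeight_mul h K d m 1
    have h1 := integral_mul_step_le h hirr (m * d) d (fun i => Real.exp (d * K i)) ξ ρ hstep
      (measurable_gridWeight K Λ d m) hint fun ω => (gridWeight_pos K Λ d m ω).le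
    have e : ∀ ω, gridWeight K Λ d (m + 1) ω * ξ (Λ ((m + 1 : ℕ) * d) ω)
        = gridWeight K Λ d m ω *
          (Real.exp (d * K (Λ (m * d) ω)) * ξ (Λ (m * d + d) ω)) := by
      intro ω
      rw [gridWeight, Finset.prod_range_succ, ← gridWeight, mul_assoc]
      push_cast
      rw [add_mul, one_mul]
    simp_rw [e]
    refine h1.trans ?_
    rw [pow_succ', mul_assoc]
    exact mul_le_mul_of_nonneg_left ih hρ

theorem gridTime_eq {d : ℝ≥0} (hd : 0 < d) (k : ℕ) {s : ℝ} (h1 : k * (d : ℝ) ≤ s)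
    (h2 : s < (k + 1) * (d : ℝ)) : gridTime d s = k * d := by
  have hd' : (0 : ℝ) < d := hd
  have hfl : ⌊s / (d : ℝ)⌋ = (k : ℤ) := by
    rw [Int.floor_eq_iff, le_div_iff₀ hd', div_lt_iff₀ hd']
    exact ⟨by exact_mod_cast h1, by exact_mod_cast h2⟩
  rw [gridTime, hfl]
  ext
  rw [Real.coe_toNNReal _ (by positivity)]
  push_cast
  rfl

/-- The integrand is constant on the grid intervals, so the exponential of its integral is the
weight of the complete steps before `t` times the contribution of the last, incomplete one. -/
theorem exp_integral_gridTime {d : ℝ≥0} (hd : 0 < d) (K : Fin N → ℝ) (Λ : ℝ≥0 → Ω → Fin N)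
    (ω : Ω) {t : ℝ} (ht : 0 ≤ t) :
    Real.exp (∫ s in (0 : ℝ)..t, K (Λ (gridTime d s) ω))
      = gridWeight K Λ d ⌊t / d⌋₊ ω *
        Real.exp ((t - ⌊t / d⌋₊ * d) * K (Λ ((⌊t / d⌋₊ : ℕ) * d) ω)) := by
  have hd' : (0 : ℝ) < d := hd
  set m := ⌊t / d⌋₊ with hm
  have hmt : m * (d : ℝ) ≤ t := by
    rw [← le_div_iff₀ hd']
    exact Nat.floor_le (by positivity)
  have htm : t ≤ (m + 1) * (d : ℝ) := by
    rw [← div_le_iff₀ hd']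
    exact (Nat.lt_floor_add_one _).le
  have hpiece : ∀ (k : ℕ) {b : ℝ}, k * (d : ℝ) ≤ b → b ≤ (k + 1) * (d : ℝ) →
      IntervalIntegrable (fun s => K (Λ (gridTime d s) ω)) volume (k * d) b ∧
      ∫ s in (k * (d : ℝ))..b, K (Λ (gridTime d s) ω) = (b - k * d) * K (Λ (k * d) ω) := by
    intro k b hb1 hb2
    have heq : Set.EqOn (fun _ => K (Λ (k * d) ω)) (fun s => K (Λ (gridTime d s) ω))
        (Set.uIoo (k * (d : ℝ)) b) := by
      rw [Set.uIoo_of_le hb1]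
      intro s hs
      simp only
      rw [gridTime_eq hd k hs.1.le (hs.2.trans_le hb2)]
    refine ⟨IntervalIntegrable.congr_uIoo intervalIntegrable_const heq, ?_⟩
    rw [← intervalIntegral.integral_congr_uIoo heq, intervalIntegral.integral_const, smul_eq_mul]
  have hle : ∀ k : ℕ, k * (d : ℝ) ≤ (k + 1 : ℕ) * (d : ℝ) := fun k => by
    push_cast; nlinarith
  have hle' : ∀ k : ℕ, (k + 1 : ℕ) * (d : ℝ) ≤ (k + 1) * (d : ℝ) := fun k => by
    push_cast; exact le_rfl
  have hint : ∀ k < m, IntervalIntegrable (fun s => K (Λ (gridTime d s) ω)) volume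
      (k * (d : ℝ)) ((k + 1 : ℕ) * (d : ℝ)) := fun k _ => (hpiece k (hle k) (hle' k)).1
  have hsum := intervalIntegral.sum_integral_adjacent_intervals (a := fun k : ℕ => k * (d : ℝ)) hint
  have hint0 := IntervalIntegrable.trans_iterate (a := fun k : ℕ => k * (d : ℝ)) hint
  simp only [Nat.cast_zero, zero_mul] at hsum hint0
  rw [← intervalIntegral.integral_add_adjacent_intervals hint0 (hpiece m hmt htm).1, ← hsum,
    (hpiece m hmt htm).2, Real.exp_add, Real.exp_sum, gridWeight]
  congr 1
  refine Finset.prod_congr rfl fun k _ => ?_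
  rw [(hpiece k (hle k) (hle' k)).2]
  push_cast
  ring_nf

end GridFunctional

open scoped Matrix in
/-- A positive strict supersolution of `Q + diag K` at level `-η / 2`. Shifting by `3 η / 4`, strictly
between `η / 2` and `η`, leaves the spectrum in the open left half plane and the inequality strict. -/
theorem exists_ge_one_mulVec_lt_of_etaK_pos {N : ℕ} (hN : 2 ≤ N) (Q : Matrix (Fin N) (Fin N) ℝ)
    (hQ : IsQMatrix Q) (K : Fin N → ℝ) (hη : 0 < etaK Q K) :
    ∃ ξ : Fin N → ℝ, (∀ i, 1 ≤ ξ i) ∧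
      ∀ i, ((Q + Matrix.diagonal K) *ᵥ ξ) i < -(etaK Q K / 2) * ξ i := by
  have : Nonempty (Fin N) := ⟨⟨0, by omega⟩⟩
  set η := etaK Q K
  obtain ⟨ξ, h1, h2⟩ := exists_ge_one_mulVec_nonpos
    (Q + Matrix.diagonal K + (3 / 4 * η) • (1 : Matrix (Fin N) (Fin N) ℝ))
    (fun i j hij => by simpa [hij] using hQ.offDiag_nonneg i j hij)
    (fun z hz => by
      have e : (Q + Matrix.diagonal K + (3 / 4 * η) • (1 : Matrix (Fin N) (Fin N) ℝ)).map
            (algebraMap ℝ ℂ)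
          = algebraMap ℂ (Matrix (Fin N) (Fin N) ℂ) ((3 / 4 * η : ℝ) : ℂ)
            + (Q + Matrix.diagonal K).map (algebraMap ℝ ℂ) := by
        ext i j
        rcases eq_or_ne i j with rfl | hij
        · simp [Algebra.algebraMap_eq_smul_one]; ring
        · simp [hij, Algebra.algebraMap_eq_smul_one]
      have h3 : z - ((3 / 4 * η : ℝ) : ℂ) ∈
          spectrum ℂ ((Q + Matrix.diagonal K).map (algebraMap ℝ ℂ)) := by
        rw [← spectrum.add_mem_add_iff (s := ((3 / 4 * η : ℝ) : ℂ)), sub_add_cancel, ← e]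
        exact hz
      have h4 := (neg_etaK_isGreatest hN Q K).2 ⟨_, h3, rfl⟩
      rw [Complex.sub_re, Complex.ofReal_re] at h4
      linarith)
  refine ⟨ξ, h1, fun i => ?_⟩
  have h3 := h2 i
  rw [Matrix.add_mulVec, Matrix.smul_mulVec, Matrix.one_mulVec] at h3
  simp only [Pi.add_apply, Pi.smul_apply, smul_eq_mul] at h3
  have h5 := mul_pos hη (zero_lt_one.trans_le (h1 i))
  linarith

theorem lemma4p1 {N : ℕ} (hN : 2 ≤ N) (Q : Matrix (Fin N) (Fin N) ℝ) (hQ : IsQMatrix Q)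
    (hirr : QIrreducible Q) (K : Fin N → ℝ) (hη : 0 < etaK Q K) :
    ∃ δ₀ c : ℝ, 0 < δ₀ ∧ δ₀ < 1 ∧ 0 < c ∧
      ∀ (Ω : Type*) [MeasurableSpace Ω] (μ : Measure Ω) [IsProbabilityMeasure μ]
        (Λ : ℝ≥0 → Ω → Fin N), IsMarkovChain Q μ Λ →
        ∀ δ : ℝ, 0 < δ → δ < δ₀ → ∀ t : ℝ, 0 < t →
          Integrable (fun ω => Real.exp (∫ s in (0 : ℝ)..t, K (Λ (gridTime δ s) ω))) μ ∧
          ∫ ω, Real.exp (∫ s in (0 : ℝ)..t, K (Λ (gridTime δ s) ω)) ∂μ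
            ≤ c * Real.exp (-(etaK Q K) * t / 2) := by
  obtain ⟨ξ, hξ1, hξ⟩ := exists_ge_one_mulVec_lt_of_etaK_pos hN Q hQ K hη
  set η := etaK Q K
  obtain ⟨δ₁, hδ₁, hsmall⟩ := mem_nhdsGT_iff_exists_Ioo_subset.1
    (eventually_exp_smul_mulVec_le Q K ξ (η / 2) hξ)
  have hδ₁ : 0 < δ₁ := hδ₁
  set M := ∑ i, |K i|
  set C := ∑ i, ξ i
  have hKM : ∀ i, K i ≤ M := fun i =>
    (le_abs_self _).trans (Finset.single_le_sum (fun j _ => abs_nonneg (K j)) (Finset.mem_univ i))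
  have hξC : ∀ i, ξ i ≤ C := fun i =>
    Finset.single_le_sum (fun j _ => zero_le_one.trans (hξ1 j)) (Finset.mem_univ i)
  have hC : 0 < C := zero_lt_one.trans_le ((hξ1 ⟨0, by omega⟩).trans (hξC _))
  have hM : 0 ≤ M := Finset.sum_nonneg fun i _ => abs_nonneg _
  -- `exp M` bounds the last, incomplete step; `exp (η / 2)` makes up for the decay lost by rounding
  -- `t` down to the grid. Both use `δ < 1`.
  refine ⟨min δ₁ (1 / 2), Real.exp M * C * Real.exp (η / 2), by positivity,
    (min_le_right _ _).trans_lt (by norm_num), by positivity, ?_⟩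
  intro Ω _ μ _ Λ h δ hδ0 hδ t ht
  have hstep := hsmall ⟨hδ0, hδ.trans_le (min_le_left _ _)⟩
  have hδ1 : δ < 1 := hδ.trans_le ((min_le_right _ _).trans (by norm_num))
  lift δ to ℝ≥0 using hδ0.le
  have hd : 0 < δ := hδ0
  simp_rw [exp_integral_gridTime hd K Λ _ ht.le]
  set m := ⌊t / δ⌋₊
  have hmt : m * (δ : ℝ) ≤ t := by
    rw [← le_div_iff₀ hδ0]
    exact Nat.floor_le (by positivity)
  have htm : t ≤ (m + 1) * (δ : ℝ) := by
    rw [← div_le_iff₀ hδ0]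
    exact (Nat.lt_floor_add_one _).le
  have hint := integrable_gridWeight_mul h K δ m fun i => Real.exp ((t - m * δ) * K i)
  refine ⟨hint, ?_⟩
  calc ∫ ω, gridWeight K Λ δ m ω * Real.exp ((t - m * δ) * K (Λ (m * δ) ω)) ∂μ
      ≤ ∫ ω, Real.exp M * (gridWeight K Λ δ m ω * ξ (Λ (m * δ) ω)) ∂μ := by
        refine integral_mono hint ((integrable_gridWeight_mul h K δ m ξ).const_mul _) fun ω => ?_
        have h1 : Real.exp ((t - m * δ) * K (Λ (m * δ) ω)) ≤ Real.exp M := by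
          refine Real.exp_le_exp.2 ?_
          have h3 : (t - m * δ) * K (Λ (m * δ) ω) ≤ (t - m * δ) * M :=
            mul_le_mul_of_nonneg_left (hKM _) (by linarith)
          have h4 : (t - m * δ) * M ≤ 1 * M := mul_le_mul_of_nonneg_right (by linarith) hM
          linarith
        have h2 : Real.exp M ≤ Real.exp M * ξ (Λ (m * δ) ω) :=
          le_mul_of_one_le_right (Real.exp_pos _).le (hξ1 _)
        calc _ ≤ gridWeight K Λ δ m ω * (Real.exp M * ξ (Λ (m * δ) ω)) :=
              mul_le_mul_of_nonneg_left (h1.trans h2) (gridWeight_pos K Λ δ m ω).le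
          _ = _ := by ring
    _ = Real.exp M * ∫ ω, gridWeight K Λ δ m ω * ξ (Λ (m * δ) ω) ∂μ := integral_const_mul _ _
    _ ≤ Real.exp M * (Real.exp (-(η / 2) * δ) ^ m * C) := by
        gcongr
        exact integral_gridWeight_mul_le h hirr K ξ δ (Real.exp_pos _).le hξC hstep m
    _ ≤ Real.exp M * ((Real.exp (η / 2) * Real.exp (-η * t / 2)) * C) := by
        rw [← Real.exp_nat_mul, ← Real.exp_add]
        gcongr
        nlinarith
    _ = _ := by ring
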